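/- **Conventions.** All random variables take values in standard Borel spaces; maps between such spaces are measurable. A *generalized probability distance* is a poset $(\mathcal D,\preceq)$ with a map $D$ assigning to the laws of any two random variables $X,X'$ on the same space an element $D(X,X')\in\mathcal D$ such that * (post-processing) $D(g(X),g(X'))\preceq D(X,X')$ for every $g$; * (joint convexity) if $D(X_i,X'_i)\preceq d$ for all $i\in\mathcal I$ (the laws depending measurably on $i$) and $I$ is a random index in $\mathcal I$, independent of these families, then $D(X_I,X'_I)\preceq d$. $\mathcal D$ is *complete* if every nonempty subset has a supremum. A map $f:\mathcal D\to\mathcal D$ is *continuous* if $f(\sup S)=\sup f(S)$ for every nonempty $S\subseteq\mathcal D$. $D$ satisfies the *chain rule* if for all finitely supported $X,X'$ on the same space there is a function $\mathrm{ChainRule}_{X,X'}:\mathcal D^{\operatorname{supp}X\cap\operatorname{supp}X'}\to\mathcal D$, continuous in each variable, such that $$D((X,Y),(X',Y'))=\mathrm{ChainRule}_{X,X'}\Big(\big(D(Y|_{X=x},\,Y'|_{X'=x})\big)_{x\in\operatorname{supp}X\cap\operatorname{supp}X'}\Big)$$ for all $Y,Y'$ on a common space, $Y$ jointly distributed with $X$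 and $Y'$ with $X'$. An element $d\in\mathcal D$ satisfies the *coupling property* if whenever $D(X,X')\preceq d$ and $D(Y,Y')\preceq d$, there are couplings $(X,Y)$ and $(X',Y')$ with $D((X,Y),(X',Y'))\preceq d$. In an *interactive protocol* two randomized parties $A$ (with an input) and $B$ have independent uniform coins $r_A,r_B\in\{0,1\}^{\mathbb N}$; for $i=0,1,2,\dots$ the message $m_i$ is a function of $A$'s input, coins and received messages if $i$ is even, and of $B$'s coins and received messages if $i$ is odd; messages are binary strings or $\mathtt{halt}$, and the interaction ends with the first $\mathtt{halt}$. A mechanism plays the role of $A$, its input being the dataset, and an adversary plays the role of $B$, without input; the view $\mathrm{View}(B\leftrightarrow\mathcal M(x))=(r_B,m_0,m_2,\dots)$ consists of $B$'s coins and all messages it receives. $\mathcal M$ is *$d$-$\mathcal D$ DP* if $D(\mathrm{View}(B\leftrightarrow\mathcal M(x)),\mathrm{View}(B\leftrightarrow\mathcal M(x')))\preceq d$ for every adversary $B$ and all neighboring $x,x'$. $\mathcal M$ has *finite communication* if for every $x$ there is a constant $c$ such that, for all coins and all received strings $q_1,\dots,q_n$: if $\max\{2n,|q_1|,\dots,|q_n|\}>c$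 then $\mathcal M(x,q_1,\dots,q_n;r)=\mathtt{halt}$, and otherwise $\sum_{j=0}^{n}|\mathcal M(x,q_1,\dots,q_j;r)|\le c$ (with $|\mathtt{halt}|=0$). **Theorem.** Let $(\mathcal D,\preceq,D)$ be a generalized probability distance such that $(\mathcal D,\preceq)$ is complete, $D$ satisfies the chain rule, and every $d\in\mathcal D$ satisfies the coupling property. Then for every set of datasets with a binary neighboring relation, every $d\in\mathcal D$, every interactive $d$-$\mathcal D$ DP mechanism $\mathcal M$ with finite communication, and every pair of neighboring datasets $x,x'$, there exist random variables $Y,Y'$ on a common space with $D(Y,Y')\preceq d$ and a randomized interactive post-processing mechanism $\mathcal P$ (a randomized party $A$ whose input is a value of $Y$ or $Y'$) such that for every adversary $B$ $$\mathrm{View}(B\leftrightarrow\mathcal M(x))\equiv\mathrm{View}(B\leftrightarrow\mathcal P(Y)),\qquad \mathrm{View}(B\leftrightarrow\mathcal M(x'))\equiv\mathrm{View}(B\leftrightarrow\mathcal P(Y')),$$ where $\equiv$ denotes equality in distribution. -/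

import Mathlib

open MeasureTheory ProbabilityTheory

namespace InteractiveDP

/-! ### Interactive algorithms and views -/

/-- A message of a protocol: the special message `halt` or a binary string. -/
inductive Message : Type
  | halt : Message
  | str (s : List Bool) : Message

namespace Message

/-- The bit length of a message; `halt` counts as length `0`. -/
def bitLength : Message → ℕ
  | halt => 0
  | str s => s.length

/-- Messages correspond to optional binary strings. -/
def toOption : Message → Option (List Bool)
  | halt => none
  | str s => some s

theorem toOption_injective : Function.Injective toOption := by
  intro a b h
  cases a <;> cases b <;> simp_all [toOption]

instance : Countable Message := toOption_injective.countable

instance : MeasurableSpace Message := ⊤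

instance : DiscreteMeasurableSpace Message := ⟨fun _ => trivial⟩

instance : MeasurableSpace (Option Message) := ⊤

instance : DiscreteMeasurableSpace (Option Message) := ⟨fun _ => trivial⟩

end Message

/-- Random coins: an infinite sequence of bits. -/
abbrev Coins : Type := ℕ → Bool

/-- The uniform distribution on the coins: independent fair bits. -/
noncomputable def coinLaw : ProbabilityMeasure Coins :=
  ⟨Measure.infinitePi fun _ => (PMF.uniformOfFintype Bool).toMeasure, inferInstance⟩

/-- A deterministic party: it maps the tuple of binary strings received so far to its next
message. (A received `halt` ends the interaction, so no party ever has to react to it.) -/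
abbrev Strategy : Type := List (List Bool) → Message

/-- A randomized party of an interactive protocol with inputs in `𝒳`: a function of the input, of
the binary strings received so far and of the random coins. -/
structure InteractiveAlgorithm (𝒳 : Type*) where
  next : 𝒳 → List (List Bool) → Coins → Message
  measurable_next : ∀ x l, Measurable (next x l)

/-- Adversaries are randomized parties without input. -/
abbrev Adversary : Type := InteractiveAlgorithm Unit

/-- A randomized interactive post-processing of values in `𝒴`: a randomized party whose input is a
point of `𝒴`, measurable in the input and the coins together. -/
structure PostProcessing (𝒴 : Type*) [MeasurableSpace 𝒴] extends InteractiveAlgorithm 𝒴 where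
  jointly_measurable : ∀ l, Measurable fun p : 𝒴 × Coins => next p.1 l p.2

/-- The state after `n` full exchanges between `a`, who sends the first message, and `b`: the
strings sent by `a` and the strings sent by `b`, or `none` if one of them has halted. -/
def history (a b : Strategy) : ℕ → Option (List (List Bool) × List (List Bool))
  | 0 => some ([], [])
  | n + 1 =>
    match history a b n with
    | none => none
    | some (fromA, fromB) =>
      match a fromB with
      | .halt => none
      | .str m =>
        match b (fromA ++ [m]) with
        | .halt => none
        | .str q => some (fromA ++ [m], fromB ++ [q])

/-- The sequence of all messages that `b` receives from `a`: the entry at `n` is the message with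
number `2 * n` of the protocol, or `none` if the interaction has ended before. -/
def received (a b : Strategy) (n : ℕ) : Option Message :=
  (history a b n).map fun h => a h.2

/-- Views of the adversary: its coins and the messages it has received. -/
abbrev View : Type := Coins × (ℕ → Option Message)

theorem measurable_of_countable_dep {Ω H Z : Type*} [MeasurableSpace Ω] [MeasurableSpace Z]
    [Countable H] {F : H → Ω → Z} (hF : ∀ h, Measurable (F h)) {g : Ω → H}
    (hg : Measurable[_, ⊤] g) : Measurable fun ω => F (g ω) ω := by
  let _ : MeasurableSpace H := ⊤
  have : DiscreteMeasurableSpace H := ⟨fun _ => trivial⟩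
  have h : Measurable fun p : H × Ω => F p.1 p.2 := measurable_from_prod_countable_right hF
  exact h.comp (Measurable.prodMk hg measurable_id)

theorem measurable_history {Ω : Type*} [MeasurableSpace Ω] {a b : Ω → Strategy}
    (ha : ∀ l, Measurable fun ω => a ω l) (hb : ∀ l, Measurable fun ω => b ω l) (n : ℕ) :
    Measurable[_, ⊤] fun ω => history (a ω) (b ω) n := by
  induction n with
  | zero => exact measurable_const
  | succ n ih =>
    let _ : MeasurableSpace (Option (List (List Bool) × List (List Bool))) := ⊤
    refine measurable_of_countable_dep (g := fun ω => history (a ω) (b ω) n)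
      (F := fun h ω => match h with
        | none => none
        | some (fromA, fromB) =>
          match a ω fromB with
          | .halt => none
          | .str m =>
            match b ω (fromA ++ [m]) with
            | .halt => none
            | .str q => some (fromA ++ [m], fromB ++ [q])) ?_ ih
    rintro (_ | ⟨fromA, fromB⟩)
    · exact measurable_const
    · refine measurable_of_countable_dep (g := fun ω => a ω fromB)
        (F := fun k ω => match k with
          | .halt => none
          | .str m =>
            match b ω (fromA ++ [m]) with
            | .halt => none
            | .str q => some (fromA ++ [m], fromB ++ [q])) ?_ (ha fromB)
      rintro (_ | m)
      · exact measurable_const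
      · exact measurable_of_countable_dep (g := fun ω => b ω (fromA ++ [m]))
          (F := fun k _ => match k with
            | .halt => none
            | .str q => some (fromA ++ [m], fromB ++ [q]))
          (fun _ => measurable_const) (hb _)

theorem measurable_received {Ω : Type*} [MeasurableSpace Ω] {a b : Ω → Strategy}
    (ha : ∀ l, Measurable fun ω => a ω l) (hb : ∀ l, Measurable fun ω => b ω l) :
    Measurable fun ω => received (a ω) (b ω) := by
  refine measurable_pi_lambda _ fun n => ?_
  refine measurable_of_countable_dep (g := fun ω => history (a ω) (b ω) n)
    (F := fun h ω => h.map fun k => a ω k.2) ?_ (measurable_history ha hb n)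
  rintro (_ | ⟨fromA, fromB⟩)
  · exact measurable_const
  · exact (Measurable.of_discrete (f := fun m : Message => some m)).comp (ha fromB)

/-- The distribution of the view of `B` in the interaction with the random party `a ω`, where `ω`
has law `μ` and is independent of the coins of `B`. -/
noncomputable def viewLaw {Ω : Type*} [MeasurableSpace Ω] (μ : ProbabilityMeasure Ω)
    (a : Ω → Strategy) (ha : ∀ l, Measurable fun ω => a ω l) (B : Adversary) :
    ProbabilityMeasure View :=
  (μ.prod coinLaw).map
    (f := fun p : Ω × Coins => (p.2, received (a p.1) fun l => B.next () l p.2))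
    (Measurable.prodMk measurable_snd
      (measurable_received (a := fun p : Ω × Coins => a p.1)
        (b := fun p : Ω × Coins => fun l => B.next () l p.2)
        (fun l => (ha l).comp measurable_fst)
        fun l => (B.measurable_next () l).comp measurable_snd)).aemeasurable

/-- `View(B ↔ M(x))`. -/
noncomputable def InteractiveAlgorithm.view {𝒳 : Type*} (M : InteractiveAlgorithm 𝒳) (x : 𝒳)
    (B : Adversary) : ProbabilityMeasure View :=
  viewLaw coinLaw (fun r l => M.next x l r) (M.measurable_next x) B

/-- `View(B ↔ P(Y))`, where `Y` has law `μ` and is independent of the coins of `P` and `B`. -/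
noncomputable def PostProcessing.view {𝒴 : Type*} [MeasurableSpace 𝒴] (P : PostProcessing 𝒴)
    (μ : ProbabilityMeasure 𝒴) (B : Adversary) : ProbabilityMeasure View :=
  viewLaw (μ.prod coinLaw) (fun p l => P.next p.1 l p.2) P.jointly_measurable B

/-- Finite communication: for every input there is a constant `c` such that the party halts as soon
as the round number (`2 * l.length` after having received the strings `l`) or the length of a
received string exceeds `c`, and otherwise has sent messages of total length at most `c`. -/
def InteractiveAlgorithm.FiniteCommunication {𝒳 : Type*} (M : InteractiveAlgorithm 𝒳) : Prop :=
  ∀ x, ∃ c : ℕ, ∀ (r : Coins) (l : List (List Bool)),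
    ((c < 2 * l.length ∨ ∃ q ∈ l, c < q.length) → M.next x l r = .halt) ∧
    ((2 * l.length ≤ c ∧ ∀ q ∈ l, q.length ≤ c) →
      ∑ j ∈ Finset.range (l.length + 1), (M.next x (l.take j) r).bitLength ≤ c)

/-! ### Generalized probability distances

Random variables take values in standard Borel spaces, and are represented by their laws. -/

/-- A generalized probability distance with values in the poset `𝒟`. -/
structure GeneralizedDistance (𝒟 : Type*) [PartialOrder 𝒟] where
  /-- The distance between two random variables over the same space. -/
  dist : ∀ {Ω : Type} [MeasurableSpace Ω] [StandardBorelSpace Ω],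
    ProbabilityMeasure Ω → ProbabilityMeasure Ω → 𝒟
  /-- Closure under post-processing. -/
  dist_map_le : ∀ {Ω Ω' : Type} [MeasurableSpace Ω] [StandardBorelSpace Ω] [MeasurableSpace Ω']
    [StandardBorelSpace Ω'] (μ μ' : ProbabilityMeasure Ω) (g : Ω → Ω') (hg : Measurable g),
    dist (μ.map hg.aemeasurable) (μ'.map hg.aemeasurable) ≤ dist μ μ'
  /-- Joint convexity: a mixture, with the same law `ν` of the random index, of pairs at distance
  at most `d` is a pair at distance at most `d`. -/
  dist_mixture_le : ∀ {ι Ω : Type} [MeasurableSpace ι] [StandardBorelSpace ι] [MeasurableSpace Ω]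
    [StandardBorelSpace Ω] (ν : ProbabilityMeasure ι) (κ κ' : Kernel ι Ω) [IsMarkovKernel κ]
    [IsMarkovKernel κ'] (d : 𝒟),
    (∀ i, dist ⟨κ i, inferInstance⟩ ⟨κ' i, inferInstance⟩ ≤ d) →
    dist ⟨(ν : Measure ι).bind κ, inferInstance⟩ ⟨(ν : Measure ι).bind κ', inferInstance⟩ ≤ d

/-- Complete posets: every nonempty subset has a supremum. -/
def IsCompletePoset (𝒟 : Type*) [PartialOrder 𝒟] : Prop :=
  ∀ S : Set 𝒟, S.Nonempty → ∃ s, IsLUB S s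

/-- Continuous functions between complete posets: `f (sup S) = sup (f '' S)` for nonempty `S`. -/
def SupContinuous {A B : Type*} [PartialOrder A] [PartialOrder B] (f : A → B) : Prop :=
  ∀ (S : Set A) (s : A), S.Nonempty → IsLUB S s → IsLUB (f '' S) (f s)

open Classical in
/-- Continuity in each variable, the other variables being fixed. -/
def ContinuousInEachVariable {S A B : Type*} [PartialOrder A] [PartialOrder B]
    (f : (S → A) → B) : Prop :=
  ∀ (i : S) (a : S → A), SupContinuous fun t => f (Function.update a i t)

/-- The points of positive probability, which is the support of a finitely supported law. -/
def atoms {Ω : Type*} [MeasurableSpace Ω] (μ : ProbabilityMeasure Ω) : Set Ω :=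
  {x | (μ : Measure Ω) {x} ≠ 0}

/-- The law is carried by a finite set. -/
def FinitelySupported {Ω : Type*} [MeasurableSpace Ω] (μ : ProbabilityMeasure Ω) : Prop :=
  ∃ s : Finset Ω, (μ : Measure Ω) (s : Set Ω)ᶜ = 0

/-- The conditional law of `Y` given `X = x`, where `π` is the joint law of `(X, Y)` and `X = x`
has positive probability. -/
noncomputable def condLaw {Ω Ω' : Type*} [MeasurableSpace Ω] [MeasurableSpace Ω']
    (π : ProbabilityMeasure (Ω × Ω')) (x : Ω)
    (hx : (π : Measure (Ω × Ω')) (Prod.fst ⁻¹' {x}) ≠ 0) : ProbabilityMeasure Ω' :=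
  haveI := cond_isProbabilityMeasure hx
  ⟨((π : Measure (Ω × Ω'))[|Prod.fst ⁻¹' {x}]).map Prod.snd,
    Measure.isProbabilityMeasure_map measurable_snd.aemeasurable⟩

theorem ne_zero_of_mem_atoms {Ω Ω' : Type*} [MeasurableSpace Ω] [MeasurableSingletonClass Ω]
    [MeasurableSpace Ω'] {π : ProbabilityMeasure (Ω × Ω')} {μ : ProbabilityMeasure Ω}
    (h : π.map measurable_fst.aemeasurable = μ) {x : Ω} (hx : x ∈ atoms μ) :
    (π : Measure (Ω × Ω')) (Prod.fst ⁻¹' {x}) ≠ 0 := by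
  subst h
  have hx' : ((π.map measurable_fst.aemeasurable : ProbabilityMeasure Ω) : Measure Ω) {x} ≠ 0 := hx
  rwa [ProbabilityMeasure.toMeasure_map,
    Measure.map_apply measurable_fst (measurableSet_singleton x)] at hx'

namespace GeneralizedDistance

variable {𝒟 : Type*} [PartialOrder 𝒟] (D : GeneralizedDistance 𝒟)

/-- The chain rule: for all finitely supported laws `μ`, `μ'` of `X`, `X'` on the same space, the
distance of `(X, Y)` and `(X', Y')` is a function, continuous in each variable and depending on `μ`
and `μ'` only, of the distances between `Y` given `X = x` and `Y'` given `X' = x`, for the common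
support points `x`. -/
def ChainRule : Prop :=
  ∀ {Ω : Type} [MeasurableSpace Ω] [StandardBorelSpace Ω] (μ μ' : ProbabilityMeasure Ω),
    FinitelySupported μ → FinitelySupported μ' →
    ∃ C : (↥(atoms μ ∩ atoms μ') → 𝒟) → 𝒟, ContinuousInEachVariable C ∧
      ∀ {Ω' : Type} [MeasurableSpace Ω'] [StandardBorelSpace Ω']
        (π π' : ProbabilityMeasure (Ω × Ω'))
        (h : π.map measurable_fst.aemeasurable = μ) (h' : π'.map measurable_fst.aemeasurable = μ'),
        D.dist π π' = C fun x => D.dist (condLaw π x (ne_zero_of_mem_atoms h x.2.1))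
          (condLaw π' x (ne_zero_of_mem_atoms h' x.2.2))

/-- The coupling property at `d`: any two pairs at distance at most `d` can be coupled to a pair at
distance at most `d`. -/
def CouplingProperty (d : 𝒟) : Prop :=
  ∀ {Ω Ω' : Type} [MeasurableSpace Ω] [StandardBorelSpace Ω] [MeasurableSpace Ω']
    [StandardBorelSpace Ω'] (μ μ' : ProbabilityMeasure Ω) (ν ν' : ProbabilityMeasure Ω'),
    D.dist μ μ' ≤ d → D.dist ν ν' ≤ d →
    ∃ π π' : ProbabilityMeasure (Ω × Ω'),
      π.map measurable_fst.aemeasurable = μ ∧ π.map measurable_snd.aemeasurable = ν ∧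
      π'.map measurable_fst.aemeasurable = μ' ∧ π'.map measurable_snd.aemeasurable = ν' ∧
      D.dist π π' ≤ d

/-- `d`-`𝒟` differential privacy of an interactive mechanism, for a neighboring relation. -/
def IsDP {𝒳 : Type*} (neighbor : 𝒳 → 𝒳 → Prop) (d : 𝒟) (M : InteractiveAlgorithm 𝒳) : Prop :=
  ∀ (B : Adversary) (x x' : 𝒳), neighbor x x' → D.dist (M.view x B) (M.view x' B) ≤ d

end GeneralizedDistance

end InteractiveDP

open InteractiveDP

namespace InteractiveDP

/-! ### Suprema and continuity in each variable -/

/-! On a fixed dataset a mechanism is a random element of `Strategy`, so `Y` and `Y'` are sought as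
laws on `Strategy`, and `PostProcessing.play` executes the sampled strategy. The mechanism's own
strategy laws may be far apart: a strategy records the replies to all possible answers, while an
adversary sees a single branch. They are replaced by laws that interact in the same way with every
deterministic adversary (`Indistinguishable`); by Fubini the same then holds for randomized
adversaries (`viewLaw_congr`).

`Representable` is proved by induction on the number of rounds, for all bounds at once, because the
bound changes from branch to branch. For a first message `m` common to both sides, let `e m` be the
supremum, over the adversary's continuations, of the distance between the conditional tails. After
any answer `q` the remaining parties are within `e m`, so the induction hypothesis represents them.
Only finitely many `q` matter, and the coupling property at `e m` joins the representatives into one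
random strategy (`exists_of_fixed_message`).

An adversary may choose its continuation separately for each `m`. Hence the chain rule function is
at most `d` on all tuples of attained distances, and by continuity in each variable also at the
tuple of suprema (`ContinuousInEachVariable.le_of_le_sup`). The chain rule then bounds by `d` the
mixture of the representatives over the first message (`representable_succ`). -/

theorem SupContinuous.monotone {A B : Type*} [PartialOrder A] [PartialOrder B] {f : A → B}
    (hf : SupContinuous f) : Monotone f := by
  intro a b hab
  have h : IsLUB {a, b} b := by
    refine ⟨?_, fun u hu => hu (by simp)⟩
    rintro y (rfl | rfl)
    · exact hab
    · exact le_rfl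
  exact (hf {a, b} b ⟨a, by simp⟩ h).1 ⟨a, by simp, rfl⟩

/-- If a function continuous in each of finitely many variables is at most `d` on a product of
nonempty sets, then it is at most `d` on everything below the suprema of these sets. -/
theorem ContinuousInEachVariable.le_of_le_sup {S A B : Type*} [Finite S] [PartialOrder A]
    [PartialOrder B] {f : (S → A) → B} (hf : ContinuousInEachVariable f) {T : S → Set A}
    {e : S → A} (hT : ∀ i, (T i).Nonempty) (he : ∀ i, IsLUB (T i) (e i)) {d : B}
    (h : ∀ t : S → A, (∀ i, t i ∈ T i) → f t ≤ d) {t : S → A} (ht : ∀ i, t i ≤ e i) :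
    f t ≤ d := by
  classical
  cases nonempty_fintype S
  -- `F` collects the coordinates already relaxed from membership in `T i` to lying below `e i`;
  -- they are relaxed one at a time.
  have key : ∀ F : Finset S, ∀ t : S → A, (∀ i ∉ F, t i ∈ T i) → (∀ i ∈ F, t i ≤ e i) →
      f t ≤ d := by
    intro F
    induction F using Finset.induction_on with
    | empty => exact fun t h1 _ => h t fun i => h1 i (by simp)
    | insert j F hj ih =>
      intro t h1 h2
      have hc : SupContinuous fun s => f (Function.update t j s) := by
        convert hf j t
      have hle : f (Function.update t j (e j)) ≤ d := by
        refine (hc (T j) (e j) (hT j) (he j)).2 ?_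
        rintro _ ⟨s, hs, rfl⟩
        refine ih _ (fun i hi => ?_) fun i hi => ?_
        · by_cases hij : i = j
          · subst hij; simpa using hs
          · simpa [hij] using h1 i (by simp [hij, hi])
        · have hij : i ≠ j := fun hij => hj (hij ▸ hi)
          simpa [hij] using h2 i (by simp [hi])
      have hmono := hc.monotone (h2 j (by simp))
      simp only [Function.update_eq_self] at hmono
      exact hmono.trans hle
  exact key Finset.univ t (by simp) fun i _ => ht i

/-! ### Conditional laws -/

theorem condLaw_map_prodMk {Ω X Z : Type*} [MeasurableSpace Ω] [MeasurableSpace X]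
    [MeasurableSingletonClass X] [MeasurableSpace Z] (μ : ProbabilityMeasure Ω) {f : Ω → X}
    {g : Ω → Z} (hf : Measurable f) (hg : Measurable g) (x : X)
    (hx : (μ.map (hf.prodMk hg).aemeasurable : Measure (X × Z)) (Prod.fst ⁻¹' {x}) ≠ 0) :
    (condLaw (μ.map (hf.prodMk hg).aemeasurable) x hx : Measure Z)
      = ((μ : Measure Ω)[|f ⁻¹' {x}]).map g := by
  have hs : MeasurableSet (Prod.fst ⁻¹' {x} : Set (X × Z)) :=
    measurable_fst (measurableSet_singleton x)
  ext s hs'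
  simp only [condLaw, ProbabilityMeasure.coe_mk, ProbabilityMeasure.toMeasure_map]
  rw [Measure.map_apply measurable_snd hs', Measure.map_apply hg hs', cond_apply hs,
    cond_apply (hf (measurableSet_singleton x)), Measure.map_apply (hf.prodMk hg) hs,
    Measure.map_apply (hf.prodMk hg) (hs.inter (measurable_snd hs'))]
  rfl

theorem condLaw_compProd {X Z : Type*} [MeasurableSpace X] [MeasurableSingletonClass X]
    [MeasurableSpace Z] (p : ProbabilityMeasure X) (κ : Kernel X Z) [IsMarkovKernel κ] (x : X)
    (hx : ((⟨(p : Measure X) ⊗ₘ κ, inferInstance⟩ : ProbabilityMeasure (X × Z)) :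
      Measure (X × Z)) (Prod.fst ⁻¹' {x}) ≠ 0) :
    condLaw ⟨(p : Measure X) ⊗ₘ κ, inferInstance⟩ x hx = ⟨κ x, inferInstance⟩ := by
  have hs : MeasurableSet (Prod.fst ⁻¹' {x} : Set (X × Z)) :=
    measurable_fst (measurableSet_singleton x)
  have key : ∀ s : Set Z, MeasurableSet s →
      ((p : Measure X) ⊗ₘ κ) (Prod.fst ⁻¹' {x} ∩ Prod.snd ⁻¹' s) = (p : Measure X) {x} * κ x s := by
    intro s h
    have : (Prod.fst ⁻¹' {x} ∩ Prod.snd ⁻¹' s : Set (X × Z)) = {x} ×ˢ s := rfl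
    rw [this, Measure.compProd_apply_prod (measurableSet_singleton x) h]
    simp
  have key' := key Set.univ MeasurableSet.univ
  simp only [Set.preimage_univ, Set.inter_univ, measure_univ, mul_one] at key'
  apply Subtype.ext
  ext s hs'
  simp only [condLaw, ProbabilityMeasure.coe_mk] at hx ⊢
  rw [key'] at hx
  rw [Measure.map_apply measurable_snd hs', cond_apply hs, key', key s hs', ← mul_assoc,
    ENNReal.inv_mul_cancel hx (measure_ne_top _ _), one_mul]

/-- The law of total probability for a random variable with countably many values. -/
theorem bind_cond_fiber {Ω X : Type*} [MeasurableSpace Ω] [MeasurableSpace X] [Countable X]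
    [MeasurableSingletonClass X] (μ : Measure Ω) [IsProbabilityMeasure μ] {f : Ω → X}
    (hf : Measurable f) (κ : Kernel X Ω)
    (hκ : ∀ x, (μ.map f) {x} ≠ 0 → κ x = μ[|f ⁻¹' {x}]) : (μ.map f).bind κ = μ := by
  ext s hs
  rw [Measure.bind_apply hs κ.aemeasurable, lintegral_countable']
  -- Both sides equal `μ (f ⁻¹' {x} ∩ s)`; at null points `κ x` is arbitrary but has weight zero.
  have : ∀ x, κ x s * (μ.map f) {x} = (μ.restrict s).map f {x} := by
    intro x
    rw [Measure.map_apply (μ := μ.restrict s) hf (measurableSet_singleton x),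
      Measure.restrict_apply (hf (measurableSet_singleton x))]
    by_cases hx : (μ.map f) {x} = 0
    · rw [hx, mul_zero]
      rw [Measure.map_apply hf (measurableSet_singleton x)] at hx
      exact (measure_mono_null Set.inter_subset_left hx).symm
    · rw [hκ x hx, Measure.map_apply hf (measurableSet_singleton x),
        cond_mul_eq_inter (hf (measurableSet_singleton x))]
  simp_rw [this]
  have h := lintegral_countable' (μ := (μ.restrict s).map f) fun _ => 1
  simp only [lintegral_const, one_mul] at h
  rw [← h, Measure.map_apply hf MeasurableSet.univ]
  simp

/-! ### Decomposition of the interaction after the first exchange -/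

/-- What remains of a party after it has received the string `q`. -/
def Strategy.rest (q : List Bool) (a : Strategy) : Strategy := fun l => a (q :: l)

theorem Strategy.measurable_rest (q : List Bool) : Measurable (Strategy.rest q) :=
  measurable_pi_lambda _ fun l => measurable_pi_apply (q :: l)

/-- The party that halts at once. -/
def Strategy.halting : Strategy := fun _ => .halt

/-- Prepend an entry to a sequence. -/
def seqCons {α : Type*} (x : α) (v : ℕ → α) : ℕ → α
  | 0 => x
  | n + 1 => v n

theorem measurable_seqCons {α : Type*} [MeasurableSpace α] (x : α) :
    Measurable (seqCons x : (ℕ → α) → ℕ → α) := by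
  refine measurable_pi_lambda _ fun n => ?_
  cases n with
  | zero => exact measurable_const
  | succ n => exact measurable_pi_apply n

/-- `history` grows at its end, whereas the induction on rounds removes the first exchange; this
recursion peels from the front. -/
theorem history_succ (a b : Strategy) (n : ℕ) :
    history a b (n + 1) =
      match a [] with
      | .halt => none
      | .str m =>
        match b [m] with
        | .halt => none
        | .str q => (history (a.rest q) (b.rest m) n).map fun h => (m :: h.1, q :: h.2) := by
  induction n with
  | zero =>
    simp only [history]
    cases a [] with
    | halt => rfl
    | str m =>
      simp only [List.nil_append]
      cases b [m] <;> rfl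
  | succ n ih =>
    rw [history, ih]
    cases a [] with
    | halt => rfl
    | str m =>
      simp only
      cases b [m] with
      | halt => rfl
      | str q =>
        simp only [history]
        cases history (a.rest q) (b.rest m) n with
        | none => rfl
        | some h =>
          simp only [Option.map_some, Strategy.rest]
          cases a (q :: h.2) with
          | halt => rfl
          | str m' =>
            simp only [List.cons_append]
            cases b (m :: (h.1 ++ [m'])) <;> rfl

theorem received_of_halt {a : Strategy} (b : Strategy) (ha : a [] = .halt) :
    received a b = seqCons (some .halt) fun _ => none := by
  funext n
  cases n with
  | zero => simp [received, history, seqCons, ha]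
  | succ n => simp [received, history_succ, seqCons, ha]

theorem received_of_answer_halt {a b : Strategy} {m : List Bool} (ha : a [] = .str m)
    (hb : b [m] = .halt) : received a b = seqCons (some (.str m)) fun _ => none := by
  funext n
  cases n with
  | zero => simp [received, history, seqCons, ha]
  | succ n => simp [received, history_succ, seqCons, ha, hb]

theorem received_of_answer_str {a b : Strategy} {m q : List Bool} (ha : a [] = .str m)
    (hb : b [m] = .str q) :
    received a b = seqCons (some (.str m)) (received (a.rest q) (b.rest m)) := by
  funext n
  cases n with
  | zero => simp [received, history, seqCons, ha]
  | succ n => simp [received, history_succ, seqCons, ha, hb, Function.comp_def, Strategy.rest]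

/-- The messages received after the first one. -/
def receivedTail (a b : Strategy) (n : ℕ) : Option Message := received a b (n + 1)

theorem received_eq_seqCons (a b : Strategy) :
    received a b = seqCons (some (a [])) (receivedTail a b) := by
  funext n
  cases n <;> rfl

theorem measurable_received_left (b : Strategy) : Measurable fun a : Strategy => received a b :=
  measurable_received (fun l => measurable_pi_apply l) fun _ => measurable_const

theorem measurable_receivedTail_left (b : Strategy) :
    Measurable fun a : Strategy => receivedTail a b :=
  measurable_pi_lambda _ fun n => (measurable_pi_apply (n + 1)).comp (measurable_received_left b)

/-- The tail of the interaction only depends on the answers of `b` to the first message. -/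
theorem receivedTail_congr {a b b' : Strategy}
    (h : ∀ m, a [] = .str m → ∀ l, b (m :: l) = b' (m :: l)) :
    receivedTail a b = receivedTail a b' := by
  funext n
  simp only [receivedTail, received, history_succ]
  cases ha : a [] with
  | halt => rfl
  | str m =>
    have hr : b.rest m = b'.rest m := funext fun l => h m ha l
    simp only [h m ha [], hr]

/-- The law of the messages that `b` receives from a random party. -/
noncomputable def recvLaw (μ : ProbabilityMeasure Strategy) (b : Strategy) :
    ProbabilityMeasure (ℕ → Option Message) :=
  μ.map (measurable_received_left b).aemeasurable

/-- The law of the messages after the first one that `b` receives from a random party. -/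
noncomputable def tailLaw (μ : ProbabilityMeasure Strategy) (b : Strategy) :
    ProbabilityMeasure (ℕ → Option Message) :=
  μ.map (measurable_receivedTail_left b).aemeasurable

/-- The law of what remains of a random party after it has received `q`. -/
noncomputable def restLaw (μ : ProbabilityMeasure Strategy) (q : List Bool) :
    ProbabilityMeasure Strategy :=
  μ.map (Strategy.measurable_rest q).aemeasurable

theorem viewLaw_apply {Ω : Type*} [MeasurableSpace Ω] (μ : ProbabilityMeasure Ω)
    (a : Ω → Strategy) (ha : ∀ l, Measurable fun ω => a ω l) (B : Adversary) {s : Set View}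
    (hs : MeasurableSet s) :
    (viewLaw μ a ha B : Measure View) s = ∫⁻ r, (μ : Measure Ω).map
      (fun ω => received (a ω) fun l => B.next () l r) (Prod.mk r ⁻¹' s)
        ∂(coinLaw : Measure Coins) := by
  have hm : Measurable fun p : Ω × Coins =>
      ((p.2, received (a p.1) fun l => B.next () l p.2) : View) :=
    Measurable.prodMk measurable_snd (measurable_received (a := fun p : Ω × Coins => a p.1)
      (b := fun p : Ω × Coins => fun l => B.next () l p.2)
      (fun l => (ha l).comp measurable_fst)
      fun l => (B.measurable_next () l).comp measurable_snd)
  rw [viewLaw, ProbabilityMeasure.toMeasure_map, Measure.map_apply hm hs,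
    ProbabilityMeasure.toMeasure_prod, Measure.prod_apply_symm (hm hs)]
  refine lintegral_congr fun r => ?_
  have hr : Measurable fun ω => received (a ω) fun l => B.next () l r :=
    measurable_received ha fun _ => measurable_const
  rw [Measure.map_apply hr (measurable_prodMk_left hs)]
  rfl

/-- Given the adversary's coins, which are independent of the party, the adversary is deterministic;
a view law is thus determined by the interactions with deterministic adversaries. -/
theorem viewLaw_congr {Ω Ω' : Type*} [MeasurableSpace Ω] [MeasurableSpace Ω']
    {μ : ProbabilityMeasure Ω} {μ' : ProbabilityMeasure Ω'} {a : Ω → Strategy} {a' : Ω' → Strategy}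
    (ha : ∀ l, Measurable fun ω => a ω l) (ha' : ∀ l, Measurable fun ω => a' ω l)
    (h : ∀ b, (μ : Measure Ω).map (fun ω => received (a ω) b)
      = (μ' : Measure Ω').map fun ω => received (a' ω) b) (B : Adversary) :
    viewLaw μ a ha B = viewLaw μ' a' ha' B := by
  apply Subtype.ext
  ext s hs
  refine (viewLaw_apply μ a ha B hs).trans (Eq.trans ?_ (viewLaw_apply μ' a' ha' B hs).symm)
  exact lintegral_congr fun r => by rw [h]

/-! ### Strategies with bounded communication -/

/-- The strategies that halt after `n` rounds or a received string longer than `c`, and only send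
messages of length at most `c`. -/
def boundedStrategies (c n : ℕ) : Set Strategy :=
  {a | ∀ l, (a l).bitLength ≤ c ∧ ((n ≤ l.length ∨ ∃ q ∈ l, c < q.length) → a l = .halt)}

theorem measurableSet_boundedStrategies (c n : ℕ) : MeasurableSet (boundedStrategies c n) := by
  have : boundedStrategies c n = ⋂ l, (fun a : Strategy => a l) ⁻¹'
      {m | m.bitLength ≤ c ∧ ((n ≤ l.length ∨ ∃ q ∈ l, c < q.length) → m = .halt)} := by
    ext a; simp [boundedStrategies]
  rw [this]
  exact MeasurableSet.iInter fun l => measurable_pi_apply l MeasurableSet.of_discrete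

theorem rest_mem_boundedStrategies {c n : ℕ} {a : Strategy} (ha : a ∈ boundedStrategies c (n + 1))
    (q : List Bool) : a.rest q ∈ boundedStrategies c n := by
  refine fun l => ⟨(ha (q :: l)).1, fun h => (ha (q :: l)).2 ?_⟩
  rcases h with h | ⟨q', hq', h⟩
  · exact Or.inl (by simpa using h)
  · exact Or.inr ⟨q', by simp [hq'], h⟩

theorem rest_eq_halting {c n : ℕ} {a : Strategy} (ha : a ∈ boundedStrategies c n)
    {q : List Bool} (hq : c < q.length) : a.rest q = Strategy.halting :=
  funext fun l => (ha (q :: l)).2 (Or.inr ⟨q, by simp, hq⟩)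

theorem eq_halting_of_mem {c : ℕ} {a : Strategy} (ha : a ∈ boundedStrategies c 0) :
    a = Strategy.halting :=
  funext fun l => (ha l).2 (Or.inl (Nat.zero_le _))

theorem finite_bitLength_le (c : ℕ) : {m : Message | m.bitLength ≤ c}.Finite := by
  refine (((List.finite_length_le Bool c).image Message.str).insert .halt).subset ?_
  intro m hm
  cases m with
  | halt => simp
  | str s => exact Or.inr ⟨s, hm, rfl⟩

/-- All larger `c` are allowed so that one constant can serve two datasets. The round bound `c + 1`
is crude: `c + 1 ≤ l.length` already forces `c₀ < 2 * l.length`. -/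
theorem InteractiveAlgorithm.FiniteCommunication.exists_mem_boundedStrategies {𝒳 : Type*}
    {M : InteractiveAlgorithm 𝒳} (hM : M.FiniteCommunication) (x : 𝒳) :
    ∃ c₀, ∀ c, c₀ ≤ c → ∀ r, (fun l => M.next x l r) ∈ boundedStrategies c (c + 1) := by
  obtain ⟨c₀, h⟩ := hM x
  refine ⟨c₀, fun c hc r l => ⟨?_, ?_⟩⟩
  · change (M.next x l r).bitLength ≤ c
    obtain ⟨h1, h2⟩ := h r l
    by_cases hl : c₀ < 2 * l.length ∨ ∃ q ∈ l, c₀ < q.length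
    · rw [h1 hl]; exact Nat.zero_le _
    · push Not at hl
      refine le_trans ?_ ((h2 hl).trans hc)
      have := Finset.single_le_sum (f := fun j => (M.next x (l.take j) r).bitLength)
        (fun _ _ => Nat.zero_le _) (Finset.self_mem_range_succ l.length)
      simpa using this
  · rintro (hl | ⟨q, hq, hl⟩)
    · exact (h r l).1 (Or.inl (by omega))
    · exact (h r l).1 (Or.inr ⟨q, hq, by omega⟩)

/-! ### Point masses -/

theorem map_const_eq_diracProba {Ω Z : Type*} [MeasurableSpace Ω] [MeasurableSpace Z]
    (μ : ProbabilityMeasure Ω) (z : Z) :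
    μ.map (measurable_const (a := z)).aemeasurable = diracProba z := by
  apply Subtype.ext
  simp [diracProba]

theorem map_eq_diracProba {Ω Z : Type*} [MeasurableSpace Ω] [MeasurableSpace Z]
    {μ : ProbabilityMeasure Ω} {z : Z} {f : Ω → Z} (hf : AEMeasurable f (μ : Measure Ω))
    (h : ∀ᵐ ω ∂(μ : Measure Ω), f ω = z) : μ.map hf = diracProba z := by
  rw [← map_const_eq_diracProba μ z]
  exact Subtype.ext (Measure.map_congr h)

theorem map_map {Ω Y Z : Type*} [MeasurableSpace Ω] [MeasurableSpace Y] [MeasurableSpace Z]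
    (μ : ProbabilityMeasure Ω) {f : Ω → Y} {g : Y → Z} (hf : AEMeasurable f (μ : Measure Ω))
    (hg : AEMeasurable g (μ.map hf : Measure Y)) :
    (μ.map hf).map hg = μ.map (hg.comp_aemeasurable hf) :=
  Subtype.ext (AEMeasurable.map_map_of_aemeasurable hg hf)

theorem map_congr {Ω Z : Type*} [MeasurableSpace Ω] [MeasurableSpace Z]
    {μ : ProbabilityMeasure Ω} {f g : Ω → Z} (hf : AEMeasurable f (μ : Measure Ω))
    (hg : AEMeasurable g (μ : Measure Ω)) (h : f =ᵐ[(μ : Measure Ω)] g) : μ.map hf = μ.map hg :=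
  Subtype.ext (Measure.map_congr h)

/-! ### Couplings of finite families -/

namespace GeneralizedDistance

variable {𝒟 : Type*} [PartialOrder 𝒟] (D : GeneralizedDistance 𝒟)

/-- A constant map is a post-processing, so a point mass compared with itself lies below every
distance, although `𝒟` need not have a least element. -/
theorem dist_diracProba_le {Ω Z : Type} [MeasurableSpace Ω] [StandardBorelSpace Ω]
    [MeasurableSpace Z] [StandardBorelSpace Z] (μ μ' : ProbabilityMeasure Ω) (z : Z) :
    D.dist (diracProba z) (diracProba z) ≤ D.dist μ μ' := by
  simpa only [map_const_eq_diracProba] using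
    D.dist_map_le μ μ' (fun _ => z) measurable_const

/-- Finitely many pairs at distance at most `e` can be coupled, the other entries of the family
being constant. -/
theorem CouplingProperty.exists_family {e : 𝒟} (he : D.CouplingProperty e)
    {I Ω : Type} [Countable I] [MeasurableSpace Ω] [StandardBorelSpace Ω]
    (ν ν' : I → ProbabilityMeasure Ω) (z : Ω) (hz : D.dist (diracProba z) (diracProba z) ≤ e)
    (Q : Finset I) (hQ : ∀ i ∈ Q, D.dist (ν i) (ν' i) ≤ e) :
    ∃ ρ ρ' : ProbabilityMeasure (I → Ω), D.dist ρ ρ' ≤ e ∧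
      (∀ i ∈ Q, ρ.map (measurable_pi_apply i).aemeasurable = ν i ∧
        ρ'.map (measurable_pi_apply i).aemeasurable = ν' i) ∧
      ∀ i ∉ Q, ρ.map (measurable_pi_apply i).aemeasurable = diracProba z ∧
        ρ'.map (measurable_pi_apply i).aemeasurable = diracProba z := by
  classical
  induction Q using Finset.induction_on with
  | empty =>
    refine ⟨diracProba fun _ => z, diracProba fun _ => z, ?_, by simp, fun i _ => ?_⟩
    · exact (D.dist_diracProba_le (diracProba z) (diracProba z) _).trans hz
    · have : (diracProba fun _ : I => z).map (measurable_pi_apply i).aemeasurable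
          = diracProba z := by
        refine map_eq_diracProba _ ?_
        have hs : MeasurableSet {f : I → Ω | f i = z} :=
          (measurable_pi_apply i : Measurable fun f : I → Ω => f i) (measurableSet_singleton z)
        rw [diracProba, ProbabilityMeasure.coe_mk, ae_dirac_iff hs]
      exact ⟨this, this⟩
  | insert j Q hj ih =>
    obtain ⟨ρ, ρ', hD, h1, h2⟩ := ih fun i hi => hQ i (by simp [hi])
    -- Couple the family built so far with the new pair, then overwrite coordinate `j`.
    obtain ⟨π, π', hf, hs, hf', hs', hπ⟩ := he ρ ρ' (ν j) (ν' j) hD (hQ j (by simp))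
    have hg : Measurable fun p : (I → Ω) × Ω => Function.update p.1 j p.2 := by
      refine measurable_pi_lambda _ fun i => ?_
      by_cases hij : i = j
      · subst hij; simpa using measurable_snd
      · simpa [hij, Function.comp_def] using (measurable_pi_apply i).comp measurable_fst
    have hself : ∀ (τ : ProbabilityMeasure ((I → Ω) × Ω)),
        (τ.map hg.aemeasurable).map (measurable_pi_apply j).aemeasurable
          = τ.map measurable_snd.aemeasurable := fun τ => by
      rw [map_map]; congr 1; funext p; simp
    have hne : ∀ (τ : ProbabilityMeasure ((I → Ω) × Ω)) (i : I), i ≠ j →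
        (τ.map hg.aemeasurable).map (measurable_pi_apply i).aemeasurable
          = (τ.map measurable_fst.aemeasurable).map (measurable_pi_apply i).aemeasurable :=
      fun τ i hij => by
        rw [map_map, map_map]; congr 1; funext p; simp [hij]
    refine ⟨π.map hg.aemeasurable, π'.map hg.aemeasurable,
      (D.dist_map_le π π' _ hg).trans hπ, fun i hi => ?_, fun i hi => ?_⟩
    · by_cases hij : i = j
      · subst hij; rw [hself, hself]; exact ⟨hs, hs'⟩
      · rw [hne _ _ hij, hne _ _ hij, hf, hf']
        exact h1 i ((Finset.mem_insert.1 hi).resolve_left hij)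
    · simp only [Finset.mem_insert, not_or] at hi
      rw [hne _ _ hi.1, hne _ _ hi.1, hf, hf']
      exact h2 i hi.2

end GeneralizedDistance

/-! ### Random parties with a fixed first message -/

/-- The strategy that starts with the message `m` and continues with `f q` after receiving `q`. -/
def Strategy.glue (m : List Bool) (f : List Bool → Strategy) : Strategy
  | [] => .str m
  | q :: l => f q l

theorem Strategy.measurable_glue (m : List Bool) : Measurable (Strategy.glue m) := by
  refine measurable_pi_lambda _ fun l => ?_
  cases l with
  | nil => exact measurable_const
  | cons q l => exact (measurable_pi_apply l).comp (measurable_pi_apply q)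

theorem recvLaw_map {Ω : Type*} [MeasurableSpace Ω] (μ : ProbabilityMeasure Ω) {f : Ω → Strategy}
    (hf : AEMeasurable f (μ : Measure Ω)) (b : Strategy) :
    recvLaw (μ.map hf) b = μ.map ((measurable_received_left b).comp_aemeasurable hf) :=
  map_map μ hf _

/-- A deterministic `b` gives a single answer `q` to `m`, or halts, so only the marginal of `ρ` at
that `q` is visible. The dependence between coordinates may therefore be any coupling. -/
theorem recvLaw_glue {μ : ProbabilityMeasure Strategy} {m : List Bool}
    (hm : ∀ᵐ a ∂(μ : Measure Strategy), a [] = .str m)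
    {ρ : ProbabilityMeasure (List Bool → Strategy)}
    (hρ : ∀ q b, recvLaw (ρ.map (measurable_pi_apply q).aemeasurable) b = recvLaw (restLaw μ q) b)
    (b : Strategy) :
    recvLaw (ρ.map (Strategy.measurable_glue m).aemeasurable) b = recvLaw μ b := by
  cases hb : b [m] with
  | halt =>
    rw [recvLaw, map_map, recvLaw, map_eq_diracProba _ (hm.mono fun a ha =>
      received_of_answer_halt ha hb)]
    exact map_eq_diracProba _ (.of_forall fun f => received_of_answer_halt (by rfl) hb)
  | str q =>
    have h := hρ q (b.rest m)
    rw [restLaw, recvLaw_map, recvLaw_map] at h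
    replace h := congrArg (fun τ => τ.map (measurable_seqCons (some (.str m))).aemeasurable) h
    beta_reduce at h
    rw [map_map, map_map] at h
    rw [recvLaw_map]
    refine Eq.trans ?_ (h.trans (map_congr _ _ ?_))
    · refine map_congr _ _ (.of_forall fun f => ?_)
      exact received_of_answer_str (by rfl) hb
    · exact hm.mono fun a ha => (received_of_answer_str ha hb).symm

/-- A law of random strategies with the same interaction as `μ` for every deterministic
adversary. -/
def Indistinguishable (ν μ : ProbabilityMeasure Strategy) : Prop :=
  ∀ b, recvLaw ν b = recvLaw μ b

/-- The statement that two laws of random strategies satisfying `P`, with interactions at distance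
at most `e`, are indistinguishable from two laws at distance at most `e`. -/
def Representable {𝒟 : Type*} [PartialOrder 𝒟] (D : GeneralizedDistance 𝒟) (P : Set Strategy) :
    Prop :=
  ∀ (e : 𝒟) (μ μ' : ProbabilityMeasure Strategy), (∀ᵐ a ∂(μ : Measure Strategy), a ∈ P) →
    (∀ᵐ a ∂(μ' : Measure Strategy), a ∈ P) → (∀ b, D.dist (recvLaw μ b) (recvLaw μ' b) ≤ e) →
    ∃ ν ν', D.dist ν ν' ≤ e ∧ Indistinguishable ν μ ∧ Indistinguishable ν' μ'

variable {𝒟 : Type*} [PartialOrder 𝒟] {D : GeneralizedDistance 𝒟}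

theorem representable_zero (c : ℕ) : Representable D (boundedStrategies c 0) := by
  intro e μ μ' hμ hμ' h
  have key : ∀ τ : ProbabilityMeasure Strategy,
      (∀ᵐ a ∂(τ : Measure Strategy), a ∈ boundedStrategies c 0) →
      diracProba Strategy.halting = τ := by
    intro τ hτ
    rw [← map_eq_diracProba measurable_id.aemeasurable (hτ.mono fun a ha => eq_halting_of_mem ha)]
    exact Subtype.ext Measure.map_id
  refine ⟨diracProba Strategy.halting, diracProba Strategy.halting,
    (D.dist_diracProba_le _ _ _).trans (h Strategy.halting), ?_, ?_⟩
  · rw [key μ hμ]; exact fun _ => rfl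
  · rw [key μ' hμ']; exact fun _ => rfl

/-- An adversary `b` facing the rest of the party is simulated by one that answers the first message
with `q` and then plays `b`. -/
theorem dist_recvLaw_restLaw_le {e : 𝒟} {μ μ' : ProbabilityMeasure Strategy} {m : List Bool}
    (hm : ∀ᵐ a ∂(μ : Measure Strategy), a [] = .str m)
    (hm' : ∀ᵐ a ∂(μ' : Measure Strategy), a [] = .str m)
    (h : ∀ b, D.dist (tailLaw μ b) (tailLaw μ' b) ≤ e) (q : List Bool) (b : Strategy) :
    D.dist (recvLaw (restLaw μ q) b) (recvLaw (restLaw μ' q) b) ≤ e := by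
  set b₀ : Strategy := fun l => match l with
    | [] => .halt
    | [_] => .str q
    | _ :: s :: l => b (s :: l)
  -- `b` and `b₀.rest m` can differ only on the empty list, on which an adversary is never
  -- consulted.
  have hrec : ∀ a : Strategy, received a b = received a (b₀.rest m) := by
    intro a
    have hh : receivedTail a b = receivedTail a (b₀.rest m) :=
      receivedTail_congr fun s _ l => rfl
    rw [received_eq_seqCons, received_eq_seqCons a, hh]
  have key : ∀ τ : ProbabilityMeasure Strategy, (∀ᵐ a ∂(τ : Measure Strategy), a [] = .str m) →
      tailLaw τ b₀ = recvLaw (restLaw τ q) b := by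
    intro τ hτ
    rw [recvLaw, restLaw, map_map]
    refine map_congr _ _ (hτ.mono fun a ha => ?_)
    funext n
    simp only [receivedTail, received_of_answer_str (b := b₀) (q := q) ha rfl, seqCons,
      Function.comp_apply, hrec]
  rw [← key μ hm, ← key μ' hm']
  exact h b₀

theorem exists_of_fixed_message {c n : ℕ} (ih : Representable D (boundedStrategies c n)) {e : 𝒟}
    (he : D.CouplingProperty e) {μ μ' : ProbabilityMeasure Strategy}
    (hμ : ∀ᵐ a ∂(μ : Measure Strategy), a ∈ boundedStrategies c (n + 1))
    (hμ' : ∀ᵐ a ∂(μ' : Measure Strategy), a ∈ boundedStrategies c (n + 1)) {m : Message}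
    (hm : ∀ᵐ a ∂(μ : Measure Strategy), a [] = m) (hm' : ∀ᵐ a ∂(μ' : Measure Strategy), a [] = m)
    (h : ∀ b, D.dist (tailLaw μ b) (tailLaw μ' b) ≤ e) :
    ∃ ν ν', D.dist ν ν' ≤ e ∧ Indistinguishable ν μ ∧ Indistinguishable ν' μ' := by
  have hdirac : D.dist (diracProba Strategy.halting) (diracProba Strategy.halting) ≤ e :=
    (D.dist_diracProba_le _ _ _).trans (h Strategy.halting)
  cases m with
  | halt =>
    have key : ∀ τ : ProbabilityMeasure Strategy, (∀ᵐ a ∂(τ : Measure Strategy), a [] = .halt) →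
        Indistinguishable (diracProba Strategy.halting) τ := by
      intro τ hτ b
      rw [recvLaw, recvLaw, map_eq_diracProba _ (hτ.mono fun a ha => received_of_halt b ha)]
      refine map_eq_diracProba _ ?_
      rw [diracProba, ProbabilityMeasure.coe_mk, ae_dirac_eq]
      exact received_of_halt b rfl
    exact ⟨_, _, hdirac, key μ hm, key μ' hm'⟩
  | str m =>
    have hrest : ∀ (τ : ProbabilityMeasure Strategy) (q : List Bool),
        (∀ᵐ a ∂(τ : Measure Strategy), a ∈ boundedStrategies c (n + 1)) →
        ∀ᵐ a ∂(restLaw τ q : Measure Strategy), a ∈ boundedStrategies c n := by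
      intro τ q hτ
      rw [restLaw, ProbabilityMeasure.toMeasure_map]
      refine (ae_map_iff (Strategy.measurable_rest q).aemeasurable
        (measurableSet_boundedStrategies c n)).2 ?_
      exact hτ.mono fun a ha => rest_mem_boundedStrategies ha q
    -- Answers longer than `c` make the party halt, so the constant coordinates outside the finite
    -- coupling are already correct.
    have hlong : ∀ (τ : ProbabilityMeasure Strategy) (q : List Bool),
        (∀ᵐ a ∂(τ : Measure Strategy), a ∈ boundedStrategies c (n + 1)) → c < q.length →
        restLaw τ q = diracProba Strategy.halting := fun τ q hτ hq =>
      map_eq_diracProba _ (hτ.mono fun a ha => rest_eq_halting ha hq)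
    choose ν ν' hν hνμ hνμ' using fun q => ih e (restLaw μ q) (restLaw μ' q) (hrest μ q hμ)
      (hrest μ' q hμ') (dist_recvLaw_restLaw_le hm hm' h q)
    obtain ⟨ρ, ρ', hρ, h1, h2⟩ := GeneralizedDistance.CouplingProperty.exists_family D he ν ν'
      Strategy.halting hdirac (List.finite_length_le Bool c).toFinset fun q _ => hν q
    refine ⟨ρ.map (Strategy.measurable_glue m).aemeasurable,
      ρ'.map (Strategy.measurable_glue m).aemeasurable, 
      (D.dist_map_le ρ ρ' _ (Strategy.measurable_glue m)).trans hρ,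
      recvLaw_glue hm fun q b => ?_, recvLaw_glue hm' fun q b => ?_⟩
    · by_cases hq : q ∈ (List.finite_length_le Bool c).toFinset
      · rw [(h1 q hq).1, hνμ q b]
      · rw [(h2 q hq).1, hlong μ q hμ (by simpa using hq)]
    · by_cases hq : q ∈ (List.finite_length_le Bool c).toFinset
      · rw [(h1 q hq).2, hνμ' q b]
      · rw [(h2 q hq).2, hlong μ' q hμ' (by simpa using hq)]

/-! ### The first message -/

theorem Strategy.measurable_first : Measurable fun a : Strategy => a [] := measurable_pi_apply []

/-- The law of the first message of a random party. -/
noncomputable def firstLaw (μ : ProbabilityMeasure Strategy) : ProbabilityMeasure Message :=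
  μ.map Strategy.measurable_first.aemeasurable

theorem measure_first_ne_zero {μ : ProbabilityMeasure Strategy} {m : Message}
    (hm : m ∈ atoms (firstLaw μ)) : (μ : Measure Strategy) ((fun a => a []) ⁻¹' {m}) ≠ 0 := by
  rwa [← Measure.map_apply Strategy.measurable_first (measurableSet_singleton m)]

/-- The conditional law of a random party given its first message. -/
noncomputable def fiberLaw (μ : ProbabilityMeasure Strategy) (m : Message)
    (hm : m ∈ atoms (firstLaw μ)) : ProbabilityMeasure Strategy :=
  ⟨(μ : Measure Strategy)[|(fun a => a []) ⁻¹' {m}],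
    cond_isProbabilityMeasure (measure_first_ne_zero hm)⟩

theorem ae_fiberLaw {μ : ProbabilityMeasure Strategy} {m : Message}
    (hm : m ∈ atoms (firstLaw μ)) {P : Strategy → Prop} (h : ∀ᵐ a ∂(μ : Measure Strategy), P a) :
    ∀ᵐ a ∂(fiberLaw μ m hm : Measure Strategy), P a :=
  cond_absolutelyContinuous.ae_le h

theorem ae_fiberLaw_first {μ : ProbabilityMeasure Strategy} {m : Message}
    (hm : m ∈ atoms (firstLaw μ)) : ∀ᵐ a ∂(fiberLaw μ m hm : Measure Strategy), a [] = m :=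
  ae_cond_mem (Strategy.measurable_first (measurableSet_singleton m))

theorem finitelySupported_firstLaw {c n : ℕ} {μ : ProbabilityMeasure Strategy}
    (hμ : ∀ᵐ a ∂(μ : Measure Strategy), a ∈ boundedStrategies c n) :
    FinitelySupported (firstLaw μ) := by
  refine ⟨(finite_bitLength_le c).toFinset, ?_⟩
  rw [firstLaw, ProbabilityMeasure.toMeasure_map,
    Measure.map_apply Strategy.measurable_first MeasurableSet.of_discrete]
  have h : ∀ᵐ a ∂(μ : Measure Strategy), (a []).bitLength ≤ c := hμ.mono fun a ha => (ha []).1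
  refine measure_mono_null (fun a ha => ?_) h
  simpa using ha

theorem FinitelySupported.finite_atoms {Ω : Type*} [MeasurableSpace Ω] {μ : ProbabilityMeasure Ω}
    (h : FinitelySupported μ) : (atoms μ).Finite := by
  obtain ⟨s, hs⟩ := h
  refine s.finite_toSet.subset fun x hx => ?_
  by_contra hxs
  exact hx (measure_mono_null (Set.singleton_subset_iff.2 hxs) hs)

/-- A family of laws indexed by the messages, as a kernel. -/
noncomputable def messageKernel (N : Message → ProbabilityMeasure Strategy) :
    Kernel Message Strategy :=
  Kernel.ofFunOfCountable fun m => (N m : Measure Strategy)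

instance (N : Message → ProbabilityMeasure Strategy) : IsMarkovKernel (messageKernel N) :=
  ⟨fun m => (N m).2⟩

/-- The joint law of a random message with law `p` and a party with law `N m` given that this
message is `m`. -/
noncomputable def mixture (p : ProbabilityMeasure Message)
    (N : Message → ProbabilityMeasure Strategy) : ProbabilityMeasure (Message × Strategy) :=
  ⟨(p : Measure Message) ⊗ₘ messageKernel N, inferInstance⟩

theorem mixture_map_fst (p : ProbabilityMeasure Message)
    (N : Message → ProbabilityMeasure Strategy) :
    (mixture p N).map measurable_fst.aemeasurable = p :=
  Subtype.ext (Measure.fst_compProd _ _)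

theorem indistinguishable_mixture {μ : ProbabilityMeasure Strategy}
    {N : Message → ProbabilityMeasure Strategy}
    (hN : ∀ m (hm : m ∈ atoms (firstLaw μ)), Indistinguishable (N m) (fiberLaw μ m hm)) :
    Indistinguishable ((mixture (firstLaw μ) N).map measurable_snd.aemeasurable) μ := by
  classical
  intro b
  set N₀ : Message → ProbabilityMeasure Strategy := fun m =>
    if hm : m ∈ atoms (firstLaw μ) then fiberLaw μ m hm else μ with hN₀
  have hμ : (firstLaw μ : Measure Message).bind (messageKernel N₀) = μ := by
    refine bind_cond_fiber (μ : Measure Strategy) Strategy.measurable_first _ fun m hm => ?_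
    have hm' : m ∈ atoms (firstLaw μ) := hm
    simp only [messageKernel, Kernel.ofFunOfCountable, Kernel.coe_mk, hN₀, hm', dif_pos]
    rfl
  have hb := measurable_received_left b
  apply Subtype.ext
  have h1 : ((mixture (firstLaw μ) N).map measurable_snd.aemeasurable : Measure Strategy)
      = (firstLaw μ : Measure Message).bind (messageKernel N) := Measure.snd_compProd _ _
  change ((mixture (firstLaw μ) N).map measurable_snd.aemeasurable : Measure Strategy).map
    (fun a => received a b) = (μ : Measure Strategy).map fun a => received a b
  rw [h1]
  conv_rhs => rw [← hμ]
  rw [Measure.map_comp _ _ hb, Measure.map_comp _ _ hb]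
  refine Measure.bind_congr_right (ae_iff_of_countable.2 fun m hm => ?_)
  rw [Kernel.map_apply _ hb, Kernel.map_apply _ hb]
  have hm' : m ∈ atoms (firstLaw μ) := hm
  have : (N m : Measure Strategy).map (fun a => received a b)
      = (fiberLaw μ m hm' : Measure Strategy).map fun a => received a b :=
    congrArg Subtype.val (hN m hm' b)
  simpa only [messageKernel, Kernel.ofFunOfCountable, Kernel.coe_mk, hN₀, hm', dif_pos] using this

/-! ### The induction on the number of rounds -/

variable {𝒟 : Type*} [PartialOrder 𝒟] {D : GeneralizedDistance 𝒟}

/-- The joint law of the first message and the messages after it that `b` receives. -/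
noncomputable def splitLaw (μ : ProbabilityMeasure Strategy) (b : Strategy) :
    ProbabilityMeasure (Message × (ℕ → Option Message)) :=
  μ.map (Strategy.measurable_first.prodMk (measurable_receivedTail_left b)).aemeasurable

theorem splitLaw_map_fst (μ : ProbabilityMeasure Strategy) (b : Strategy) :
    (splitLaw μ b).map measurable_fst.aemeasurable = firstLaw μ := by
  rw [splitLaw, map_map]; rfl

/-- The split is a function of the received sequence; the default `halt` is never used, since entry
`0` is always present. -/
theorem dist_splitLaw_le (μ μ' : ProbabilityMeasure Strategy) (b : Strategy) :
    D.dist (splitLaw μ b) (splitLaw μ' b) ≤ D.dist (recvLaw μ b) (recvLaw μ' b) := by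
  have hg : Measurable fun v : ℕ → Option Message => ((v 0).getD .halt, fun n => v (n + 1)) :=
    ((Measurable.of_discrete (f := fun m : Option Message => m.getD .halt)).comp
      (measurable_pi_apply 0)).prodMk
      (measurable_pi_lambda _ fun n => measurable_pi_apply (n + 1))
  have key : ∀ τ : ProbabilityMeasure Strategy,
      splitLaw τ b = (recvLaw τ b).map hg.aemeasurable := by
    intro τ
    rw [recvLaw, map_map]
    rfl
  rw [key, key]
  exact D.dist_map_le _ _ _ hg

/-- Once the first message is `m`, only the behaviour of `b` after `m` matters. This lets one
adversary combine separate choices for the different `m`. -/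
theorem condLaw_splitLaw {μ : ProbabilityMeasure Strategy} {m : Message}
    (hm : m ∈ atoms (firstLaw μ)) {b b' : Strategy}
    (hb : ∀ s, m = .str s → ∀ l, b (s :: l) = b' (s :: l)) :
    condLaw (splitLaw μ b) m (ne_zero_of_mem_atoms (splitLaw_map_fst μ b) hm)
      = tailLaw (fiberLaw μ m hm) b' := by
  apply Subtype.ext
  refine (condLaw_map_prodMk μ Strategy.measurable_first (measurable_receivedTail_left b) m _).trans
    (Measure.map_congr ?_)
  filter_upwards [ae_fiberLaw_first hm] with a ha
  exact receivedTail_congr fun s hs => hb s (ha.symm.trans hs)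

theorem representable_succ (hcomplete : IsCompletePoset 𝒟) (hchain : D.ChainRule)
    (hcoupling : ∀ d : 𝒟, D.CouplingProperty d) {c n : ℕ}
    (ih : Representable D (boundedStrategies c n)) :
    Representable D (boundedStrategies c (n + 1)) := by
  classical
  intro d μ μ' hμ hμ' h
  have hfin := finitelySupported_firstLaw hμ
  obtain ⟨C, hC, hCeq⟩ := hchain (firstLaw μ) (firstLaw μ') hfin (finitelySupported_firstLaw hμ')
  have : Finite ↥(atoms (firstLaw μ) ∩ atoms (firstLaw μ')) :=
    (hfin.finite_atoms.inter_of_left _).to_subtype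
  set δ : ↥(atoms (firstLaw μ) ∩ atoms (firstLaw μ')) → Strategy → 𝒟 := fun i b =>
    D.dist (tailLaw (fiberLaw μ i i.2.1) b) (tailLaw (fiberLaw μ' i i.2.2) b)
  have hne : ∀ i, (Set.range (δ i)).Nonempty := fun i => ⟨_, Strategy.halting, rfl⟩
  -- `e i` is the worst distance between the tails after the first message `i`; no single adversary
  -- need attain it.
  choose e he using fun i => hcomplete (Set.range (δ i)) (hne i)
  have hsel : ∀ t : ↥(atoms (firstLaw μ) ∩ atoms (firstLaw μ')) → 𝒟, (∀ i, t i ∈ Set.range (δ i)) → C t ≤ d := by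
    intro t ht
    choose β hβ using ht
    -- The combined adversary reads the first message and follows the continuation selected for it.
    -- Other first messages do not enter the chain rule, so it may halt there.
    set b : Strategy := fun l => match l with
      | [] => .halt
      | s :: l => if hs : Message.str s ∈ atoms (firstLaw μ) ∩ atoms (firstLaw μ')
          then β ⟨.str s, hs⟩ (s :: l) else .halt with hb
    have hbβ : ∀ (i : ↥(atoms (firstLaw μ) ∩ atoms (firstLaw μ'))) s, (i : Message) = .str s → ∀ l, b (s :: l) = β i (s :: l) := by
      rintro ⟨m, hm⟩ s rfl l
      simp only [hb, dif_pos hm]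
    have hCt := hCeq (splitLaw μ b) (splitLaw μ' b) (splitLaw_map_fst μ b) (splitLaw_map_fst μ' b)
    have htt : t = fun i : ↥(atoms (firstLaw μ) ∩ atoms (firstLaw μ')) => D.dist
        (condLaw (splitLaw μ b) i (ne_zero_of_mem_atoms (splitLaw_map_fst μ b) i.2.1))
        (condLaw (splitLaw μ' b) i (ne_zero_of_mem_atoms (splitLaw_map_fst μ' b) i.2.2)) := by
      funext i
      rw [condLaw_splitLaw i.2.1 (hbβ i), condLaw_splitLaw i.2.2 (hbβ i)]
      exact (hβ i).symm
    rw [htt]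
    exact hCt.symm.trans_le <| (dist_splitLaw_le μ μ' b).trans (h b)
  choose ν ν' hν hνμ hνμ' using fun i : ↥(atoms (firstLaw μ) ∩ atoms (firstLaw μ')) => exists_of_fixed_message ih (hcoupling (e i))
    (ae_fiberLaw i.2.1 hμ) (ae_fiberLaw i.2.2 hμ') (ae_fiberLaw_first i.2.1)
    (ae_fiberLaw_first i.2.2) fun b => (he i).1 ⟨b, rfl⟩
  obtain ⟨N, N', hN, hNμ, hNμ'⟩ : ∃ N N' : Message → ProbabilityMeasure Strategy,
      (∀ i : ↥(atoms (firstLaw μ) ∩ atoms (firstLaw μ')), D.dist (N i) (N' i) ≤ e i) ∧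
      (∀ m (hm : m ∈ atoms (firstLaw μ)), Indistinguishable (N m) (fiberLaw μ m hm)) ∧
      ∀ m (hm : m ∈ atoms (firstLaw μ')), Indistinguishable (N' m) (fiberLaw μ' m hm) := by
    -- Off the common support the chain rule sees nothing, so the original conditional laws are
    -- kept; the last default concerns null messages only.
    refine ⟨fun m => if hm : m ∈ atoms (firstLaw μ) ∩ atoms (firstLaw μ') then ν ⟨m, hm⟩
        else if hm : m ∈ atoms (firstLaw μ) then fiberLaw μ m hm else μ,
      fun m => if hm : m ∈ atoms (firstLaw μ) ∩ atoms (firstLaw μ') then ν' ⟨m, hm⟩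
        else if hm : m ∈ atoms (firstLaw μ') then fiberLaw μ' m hm else μ', ?_, ?_, ?_⟩
    · rintro ⟨m, hm⟩
      simp only [dif_pos hm]
      exact hν ⟨m, hm⟩
    · intro m hm
      by_cases hi : m ∈ atoms (firstLaw μ) ∩ atoms (firstLaw μ')
      · simp only [dif_pos hi]
        exact hνμ ⟨m, hi⟩
      · simp only [dif_neg hi, dif_pos hm]
        exact fun _ => rfl
    · intro m hm
      by_cases hi : m ∈ atoms (firstLaw μ) ∩ atoms (firstLaw μ')
      · simp only [dif_pos hi]
        exact hνμ' ⟨m, hi⟩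
      · simp only [dif_neg hi, dif_pos hm]
        exact fun _ => rfl
  refine ⟨_, _, (D.dist_map_le (mixture (firstLaw μ) N) (mixture (firstLaw μ') N') _
    measurable_snd).trans ?_, indistinguishable_mixture hNμ, indistinguishable_mixture hNμ'⟩
  -- The same `C` applies because it depends only on the laws of the first message, which the
  -- mixtures preserve.
  rw [hCeq _ _ (mixture_map_fst _ N) (mixture_map_fst _ N')]
  refine hC.le_of_le_sup hne he hsel fun i => ?_
  refine (le_of_eq ?_).trans (hN i)
  exact congrArg₂ D.dist (condLaw_compProd _ (messageKernel N) _ _)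
    (condLaw_compProd _ (messageKernel N') _ _)

theorem representable_boundedStrategies (hcomplete : IsCompletePoset 𝒟) (hchain : D.ChainRule)
    (hcoupling : ∀ d : 𝒟, D.CouplingProperty d) (c n : ℕ) :
    Representable D (boundedStrategies c n) := by
  induction n with
  | zero => exact representable_zero c
  | succ n ih => exact representable_succ hcomplete hchain hcoupling ih

/-! ### Mechanisms as random strategies -/

theorem InteractiveAlgorithm.measurable_strategy {𝒳 : Type*} (M : InteractiveAlgorithm 𝒳)
    (x : 𝒳) : Measurable fun r => (fun l => M.next x l r : Strategy) :=
  measurable_pi_lambda _ (M.measurable_next x)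

/-- The law of the random strategy that a mechanism follows on a given input. -/
noncomputable def InteractiveAlgorithm.strategyLaw {𝒳 : Type*} (M : InteractiveAlgorithm 𝒳)
    (x : 𝒳) : ProbabilityMeasure Strategy :=
  coinLaw.map (M.measurable_strategy x).aemeasurable

/-- The adversary that ignores its coins. -/
def Adversary.deterministic (b : Strategy) : Adversary where
  next _ l _ := b l
  measurable_next _ _ := measurable_const

/-- Dropping the adversary's coins is a post-processing, so privacy of views bounds the distances of
interactions with deterministic adversaries. -/
theorem view_deterministic_map_snd {𝒳 : Type*} (M : InteractiveAlgorithm 𝒳) (x : 𝒳)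
    (b : Strategy) :
    (M.view x (Adversary.deterministic b)).map measurable_snd.aemeasurable
      = recvLaw (M.strategyLaw x) b := by
  rw [InteractiveAlgorithm.strategyLaw, recvLaw_map, InteractiveAlgorithm.view, viewLaw, map_map]
  apply Subtype.ext
  have hm : Measurable fun r => received (fun l => M.next x l r) b :=
    measurable_received (M.measurable_next x) fun _ => measurable_const
  have h : (coinLaw : Measure Coins) = ((coinLaw.prod coinLaw : ProbabilityMeasure _) :
      Measure (Coins × Coins)).map Prod.fst := by
    rw [ProbabilityMeasure.toMeasure_prod, Measure.map_fst_prod]; simp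
  change (coinLaw.prod coinLaw : Measure (Coins × Coins)).map _ = (coinLaw : Measure Coins).map _
  conv_rhs => rw [h]
  exact (Measure.map_map hm measurable_fst).symm

/-- The post-processing that plays the strategy it is given. -/
def PostProcessing.play : PostProcessing Strategy where
  next a l _ := a l
  measurable_next _ _ := measurable_const
  jointly_measurable l := (measurable_pi_apply l).comp measurable_fst

theorem view_eq_play_view {𝒳 : Type*} {M : InteractiveAlgorithm 𝒳} {x : 𝒳}
    {ν : ProbabilityMeasure Strategy} (h : Indistinguishable ν (M.strategyLaw x)) (B : Adversary) :
    M.view x B = PostProcessing.play.view ν B := by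
  refine viewLaw_congr (M.measurable_next x) PostProcessing.play.jointly_measurable (fun b => ?_) B
  have h' := h b
  rw [InteractiveAlgorithm.strategyLaw, recvLaw_map] at h'
  refine (congrArg Subtype.val h').symm.trans ?_
  have hf : (ν : Measure Strategy) = ((ν.prod coinLaw : ProbabilityMeasure _) :
      Measure (Strategy × Coins)).map Prod.fst := by
    rw [ProbabilityMeasure.toMeasure_prod, Measure.map_fst_prod]; simp
  change (ν : Measure Strategy).map (fun a => received a b) = _
  conv_lhs => rw [hf]
  exact Measure.map_map (measurable_received_left b) measurable_fst

end InteractiveDP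

open InteractiveDP
theorem mainTheorem4 {𝒟 : Type*} [PartialOrder 𝒟] (D : GeneralizedDistance 𝒟)
    (hcomplete : IsCompletePoset 𝒟) (hchain : D.ChainRule)
    (hcoupling : ∀ d : 𝒟, D.CouplingProperty d)
    {𝒳 : Type*} (neighbor : 𝒳 → 𝒳 → Prop) (d : 𝒟) (M : InteractiveAlgorithm 𝒳)
    (hfinite : M.FiniteCommunication) (hM : D.IsDP neighbor d M)
    (x x' : 𝒳) (hxx' : neighbor x x') :
    ∃ (𝒴 : Type) (_ : MeasurableSpace 𝒴) (_ : StandardBorelSpace 𝒴)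
      (Y Y' : ProbabilityMeasure 𝒴) (P : PostProcessing 𝒴),
      D.dist Y Y' ≤ d ∧
      ∀ B : Adversary, M.view x B = P.view Y B ∧ M.view x' B = P.view Y' B := by
  obtain ⟨c₁, h₁⟩ := hfinite.exists_mem_boundedStrategies x
  obtain ⟨c₂, h₂⟩ := hfinite.exists_mem_boundedStrategies x'
  -- A common bound puts both strategy laws on the same set of strategies.
  set c := max c₁ c₂
  have hae : ∀ z, (∀ r, (fun l => M.next z l r) ∈ boundedStrategies c (c + 1)) →
      ∀ᵐ a ∂(M.strategyLaw z : Measure Strategy), a ∈ boundedStrategies c (c + 1) := fun z hz =>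
    (ae_map_iff (M.measurable_strategy z).aemeasurable (measurableSet_boundedStrategies _ _)).2
      (.of_forall hz)
  obtain ⟨Y, Y', hD, hY, hY'⟩ := representable_boundedStrategies hcomplete hchain hcoupling c
    (c + 1) d (M.strategyLaw x) (M.strategyLaw x') (hae x (h₁ c (le_max_left _ _)))
    (hae x' (h₂ c (le_max_right _ _))) fun b => by
      rw [← view_deterministic_map_snd, ← view_deterministic_map_snd]
      exact (D.dist_map_le _ _ _ measurable_snd).trans (hM _ x x' hxx')
  exact ⟨Strategy, inferInstance, inferInstance, Y, Y', PostProcessing.play, hD,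
    fun B => ⟨view_eq_play_view hY B, view_eq_play_view hY' B⟩⟩
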